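/- Let $\Omega\subset\mathbb R^3$ be a bounded domain and let $\Omega^-$ be an open set with $\overline{\Omega^-}\subset\Omega$ whose boundary $\Gamma=\partial\Omega^-$ is a closed surface of class $C^2$ with $\Omega^-$ locally on one side of it. Put $\Omega^+=\Omega\setminus\overline{\Omega^-}$ and let $\vec n$ be the unit normal on $\Gamma$ pointing from $\Omega^-$ into $\Omega^+$. Let the viscosity $\mu$ be equal to a constant $\mu^+$ on $\Omega^+$ and to a constant $\mu^-$ on $\Omega^-$. Let the velocity $\vec u$ be defined on $\Omega$, of class $C^2$ on $\Omega^+\cup\Gamma$ and on $\Omega^-\cup\Gamma$ (so $\vec u$, but not its derivatives, is continuous across $\Gamma$), with trace $\vec q=\vec u|_\Gamma$. Assume that the fluids and the interface are incompressible: $\nabla\cdot\vec u=0$ in $\Omega^+$ and in $\Omega^-$, and $\nabla_s\cdot\vec q=0$ on $\Gamma$. Here $\nabla_s=(\vec I-\vec n\otimes\vec n)\nabla$ is the surface gradient, $\nabla_s\cdot$ is the surface divergence and $\nabla_s^2=\nabla_s\cdot\nabla_s$ is the surface Laplacian, applied to each component of a vector field. Off $\Gamma$, these operators are formed with any $C^1$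 vector field, on a neighbourhood of $\Gamma$, that is equal to $\vec n$ on $\Gamma$ (for instance the gradient of the signed distance to $\Gamma$). For $\vec x_\Gamma\in\Gamma$ the jump of a field $f$ is $$[f]=\lim_{\epsilon\to0^+}f(\vec x_\Gamma+\epsilon\vec n)-\lim_{\epsilon\to0^+}f(\vec x_\Gamma-\epsilon\vec n).$$ Let $\vec x_\Gamma\in\Gamma$, let $\vec n$ be the normal there, and let $\vec t,\vec b$ be any vectors such that $(\vec n,\vec t,\vec b)$ is orthonormal (for instance unit vectors along the principal directions). Let $\partial^2/\partial t^2$ and $\partial^2/\partial b^2$ be the second derivatives in the fixed directions $\vec t$ and $\vec b$. Then both jumps below exist at $\vec x_\Gamma$, and $$[\mu\nabla_s^2\vec u]\cdot\vec n=\left[\mu\left(\frac{\partial^2\vec u}{\partial t^2}+\frac{\partial^2\vec u}{\partial b^2}\right)\right]\cdot\vec n .$$ Moreover $[\mu\nabla_s^2\vec u]=(\mu^+-\mu^-)\,\nabla_s^2\vec q$, with the intrinsic surface Laplacian of $\vec q$ on $\Gamma$ on the right, so the left-hand side does not depend on the extension of $\vec n$. -/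

import Mathlib

open Set Filter Topology

noncomputable section

/-- Three-dimensional Euclidean space. -/
abbrev E3 : Type := EuclideanSpace ℝ (Fin 3)

/-- The standard basis vectors of `E3`. -/
def stdVec (i : Fin 3) : E3 := EuclideanSpace.single i 1

/-- `ψ` is a `C²` defining function, near `y`, of the set `D`: near `y` the set `D` is `{ψ < 0}`,
its boundary is `{ψ = 0}`, and the gradient of `ψ` at `y` is nonzero. -/
def IsLocalDefiningFunction (D : Set E3) (y : E3) (ψ : E3 → ℝ) : Prop :=
  ContDiffAt ℝ 2 ψ y ∧ gradient ψ y ≠ 0 ∧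
    ∀ᶠ z in 𝓝 y, (z ∈ D ↔ ψ z < 0) ∧ (z ∈ frontier D ↔ ψ z = 0)

/-- The boundary of `D` is a surface of class `C²`, with `D` locally on one side of it. -/
def HasC2Boundary (D : Set E3) : Prop :=
  ∀ y ∈ frontier D, ∃ ψ : E3 → ℝ, IsLocalDefiningFunction D y ψ

/-- `n` is the unit normal to the boundary of `D` at `y`, pointing out of `D`. -/
def IsOutwardUnitNormal (D : Set E3) (y n : E3) : Prop :=
  ∃ ψ : E3 → ℝ, IsLocalDefiningFunction D y ψ ∧ n = ‖gradient ψ y‖⁻¹ • gradient ψ y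

/-- The divergence of a vector field. -/
def divergence (v : E3 → E3) (y : E3) : ℝ :=
  ∑ i : Fin 3, (fderiv ℝ v y (stdVec i)) i

/-- The tensor `I - n ⊗ n`, that is `w ↦ w - (n · w) n`. -/
def tangProj (n : E3) : E3 →L[ℝ] E3 :=
  ContinuousLinearMap.id ℝ E3 - (innerSL ℝ n).smulRight n

/-- The surface derivative `∇ₛ f = (I - N ⊗ N) ∇ f`, as the linear map `w ↦ Df ((I - N ⊗ N) w)`;
its value at the `i`-th standard basis vector is the `i`-th component of `∇ₛ f`.
The derivative is taken within `S`. For `S` a surface with unit normal `N` this is the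
intrinsic surface derivative, which depends on the values of `f` and `N` on the surface only;
for `S = univ` the ordinary derivative is projected. -/
def surfDeriv (S : Set E3) (N : E3 → E3) {F : Type*} [NormedAddCommGroup F] [NormedSpace ℝ F]
    (f : E3 → F) (y : E3) : E3 →L[ℝ] F :=
  (fderivWithin ℝ f S y).comp (tangProj (N y))

/-- The surface divergence `∇ₛ · v`. -/
def surfDiv (S : Set E3) (N : E3 → E3) (v : E3 → E3) (y : E3) : ℝ :=
  ∑ i : Fin 3, (surfDeriv S N v y (stdVec i)) i

/-- The surface Laplacian `∇ₛ² f = ∇ₛ · ∇ₛ f`, the sum over `i` of the `i`-th component of `∇ₛ`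
applied twice. For a vector-valued `f` it acts on each component. -/
def surfLaplacian (S : Set E3) (N : E3 → E3) {F : Type*} [NormedAddCommGroup F]
    [NormedSpace ℝ F] (f : E3 → F) (y : E3) : F :=
  ∑ i : Fin 3, surfDeriv S N (fun z => surfDeriv S N f z (stdVec i)) y (stdVec i)

/-- The second derivative `∂²f/∂τ²` of `f` at `y` in the fixed direction `τ`. -/
def secondDirDeriv (τ : E3) {F : Type*} [NormedAddCommGroup F] [NormedSpace ℝ F]
    (f : E3 → F) (y : E3) : F :=
  fderiv ℝ (fun z => fderiv ℝ f z τ) y τ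

/-- `f` has the jump `[f] = J` at `x` across a surface with normal `n`: both one-sided limits
along the normal exist and `J` is the limit from the side of `n` minus the other one. -/
def HasJump {F : Type*} [NormedAddCommGroup F] [NormedSpace ℝ F]
    (f : E3 → F) (x n : E3) (J : F) : Prop :=
  ∃ a b : F, Tendsto (fun ε : ℝ => f (x + ε • n)) (𝓝[>] 0) (𝓝 a) ∧
    Tendsto (fun ε : ℝ => f (x - ε • n)) (𝓝[>] 0) (𝓝 b) ∧ J = a - b

end

/-! On either side, `u` is C² up to Γ, so its derivatives have one-sided limits there. With P = I −
n⊗n, the surface Laplacian tends to Σᵢ D(Du·Peᵢ)(Peᵢ). Only tangential derivatives occur, and curves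
in Γ show that these depend on the trace alone. Hence both sides have the same limit, the intrinsic
Laplacian of the trace.

By the product rule this limit is Σᵢ D²u(Peᵢ,Peᵢ) − Du(DN(Pn)) − tr(DN∘P) Du(n). The first sum is
the trace of D²u over the tangent plane, ∂²u/∂t² + ∂²u/∂b²; the second term vanishes since Pn = 0.
The third is normal-free: n·Du(n) is the divergence minus the surface divergence, both zero. So the
normal components agree on each side (`tendsto_surfLaplacian_and_secondDirDeriv`), and weighting by
the viscosities and subtracting gives the jumps. -/

/-! ### Local geometry of the interface -/

/-- A vector in the kernel of the derivative of a defining function is the velocity of a curve in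
the boundary. -/
theorem IsLocalDefiningFunction.exists_curve {D : Set E3} {y : E3} {ψ : E3 → ℝ}
    (hψ : IsLocalDefiningFunction D y ψ) (hy : y ∈ frontier D) {w : E3}
    (hw : fderiv ℝ ψ y w = 0) :
    ∃ γ : ℝ → E3, γ 0 = y ∧ HasDerivAt γ w 0 ∧ ∀ᶠ s in 𝓝 (0 : ℝ), γ s ∈ frontier D := by
  obtain ⟨hc, hg, hev⟩ := hψ
  have hψy : ψ y = 0 := hev.self_of_nhds.2.1 hy
  have hstr : HasStrictFDerivAt ψ (fderiv ℝ ψ y) y := hc.hasStrictFDerivAt two_ne_zero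
  have hsurj : (fderiv ℝ ψ y : E3 →ₗ[ℝ] ℝ).range = ⊤ := by
    refine LinearMap.range_eq_top.2 (LinearMap.surjective ?_)
    intro h0
    apply hg
    have h0' : fderiv ℝ ψ y = 0 := by
      ext v; exact LinearMap.congr_fun h0 v
    simp [gradient, h0']
  -- `φ` parametrises the level set of `ψ` through `y` by the kernel of its derivative, and its
  -- derivative at 0 is the inclusion of that kernel.
  set φ := hstr.implicitFunction ψ (fderiv ℝ ψ y) hsurj (ψ y) with hφ
  have hφd := (hstr.to_implicitFunction hsurj).hasFDerivAt
  have hφ0 : φ 0 = y := hstr.implicitFunction_apply_image hsurj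
  let k : (fderiv ℝ ψ y : E3 →ₗ[ℝ] ℝ).ker := ⟨w, hw⟩
  have hk : HasDerivAt (fun s : ℝ => s • k) k 0 := by
    simpa using (hasDerivAt_id (0 : ℝ)).smul_const k
  have hγ : HasDerivAt (fun s : ℝ => φ (s • k)) w 0 :=
    HasFDerivAt.comp_hasDerivAt_of_eq (f := fun s : ℝ => s • k) 0 hφd hk (by simp)
  refine ⟨fun s => φ (s • k), by simpa using hφ0, hγ, ?_⟩
  have ht : Tendsto (fun s : ℝ => φ (s • k)) (𝓝 0) (𝓝 y) := by
    have := hγ.continuousAt.tendsto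
    simpa [hφ0] using this
  have ht2 : Tendsto (fun s : ℝ => (ψ y, s • k)) (𝓝 0) (𝓝 (ψ y, 0)) := by
    refine tendsto_const_nhds.prodMk_nhds ?_
    simpa using hk.continuousAt.tendsto
  filter_upwards [ht.eventually hev, ht2.eventually (hstr.map_implicitFunction_eq hsurj)]
    with s h1 h2
  exact h1.2.2 (h2.trans hψy)

/-- The derivative within the boundary is determined in the tangent directions. -/
theorem IsLocalDefiningFunction.fderivWithin_frontier_apply {F : Type*} [NormedAddCommGroup F]
    [NormedSpace ℝ F] {D : Set E3} {y : E3} {ψ : E3 → ℝ}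
    (hψ : IsLocalDefiningFunction D y ψ) (hy : y ∈ frontier D) {f : E3 → F} {f' : E3 →L[ℝ] F}
    (hf : HasFDerivWithinAt f f' (frontier D) y) {w : E3} (hw : fderiv ℝ ψ y w = 0) :
    fderivWithin ℝ f (frontier D) y w = f' w := by
  -- A surface lacks unique derivatives in space, but both candidates must give the derivative of `f
  -- ∘ γ` at 0.
  obtain ⟨γ, h0, hγ, hmem⟩ := hψ.exists_curve hy hw
  subst h0
  exact (HasFDerivWithinAt.comp_hasDerivAt 0 hf.differentiableWithinAt.hasFDerivWithinAt hγ
    hmem).unique (HasFDerivWithinAt.comp_hasDerivAt 0 hf hγ hmem)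

theorem IsLocalDefiningFunction.norm_gradient_pos {D : Set E3} {y : E3} {ψ : E3 → ℝ}
    (hψ : IsLocalDefiningFunction D y ψ) : 0 < ‖gradient ψ y‖ :=
  norm_pos_iff.2 hψ.2.1

/-- Along the line `y + s • w` the function `ψ` vanishes at 0 with positive slope, so its sign tells
the side. -/
theorem IsLocalDefiningFunction.eventually_pos {D : Set E3} {y : E3} {ψ : E3 → ℝ}
    (hψ : IsLocalDefiningFunction D y ψ) (hy : y ∈ frontier D) {w : E3}
    (hw : 0 < fderiv ℝ ψ y w) :
    ∀ᶠ s in 𝓝[>] (0 : ℝ), y + s • w ∉ closure D ∧ y - s • w ∈ D := by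
  obtain ⟨hc, hg, hev⟩ := hψ
  have hψy : ψ y = 0 := hev.self_of_nhds.2.1 hy
  have key : ∀ v : E3, 0 < fderiv ℝ ψ y v → ∀ᶠ s in 𝓝[>] (0 : ℝ), 0 < ψ (y + s • v) := by
    intro v hv
    have hd : HasDerivAt (fun s : ℝ => y + s • v) v 0 := by
      simpa using ((hasDerivAt_id (0 : ℝ)).smul_const v).const_add y
    have h := HasFDerivAt.comp_hasDerivAt_of_eq 0
      (hc.differentiableAt two_ne_zero).hasFDerivAt hd (by simp)
    have h2 := h.tendsto_slope.mono_left
      (nhdsWithin_mono (0 : ℝ) (fun s (hs : (0 : ℝ) < s) => hs.ne'))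
    filter_upwards [h2.eventually (lt_mem_nhds hv), self_mem_nhdsWithin] with s hs hs0
    have hs0' : (0 : ℝ) < s := hs0
    rw [slope_def_field] at hs
    simpa [hψy, div_pos_iff_of_pos_right hs0'] using hs
  have key2 : ∀ᶠ s in 𝓝[>] (0 : ℝ), ψ (y - s • w) < 0 := by
    have hd : HasDerivAt (fun s : ℝ => y - s • w) (-w) 0 := by
      simpa using ((hasDerivAt_id (0 : ℝ)).smul_const w).const_sub y
    have h := HasFDerivAt.comp_hasDerivAt_of_eq 0
      (hc.differentiableAt two_ne_zero).hasFDerivAt hd (by simp)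
    have h2 := h.tendsto_slope.mono_left
      (nhdsWithin_mono (0 : ℝ) (fun s (hs : (0 : ℝ) < s) => hs.ne'))
    have hv : fderiv ℝ ψ y (-w) < 0 := by simpa using hw
    filter_upwards [h2.eventually (gt_mem_nhds hv), self_mem_nhdsWithin] with s hs hs0
    have hs0' : (0 : ℝ) < s := hs0
    rw [slope_def_field] at hs
    simpa [hψy, div_neg_iff, hs0', hs0'.not_gt] using hs
  have c1 : Tendsto (fun s : ℝ => y + s • w) (𝓝[>] 0) (𝓝 y) := by
    have : Continuous (fun s : ℝ => y + s • w) := by fun_prop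
    simpa using (this.tendsto 0).mono_left nhdsWithin_le_nhds
  have c2 : Tendsto (fun s : ℝ => y - s • w) (𝓝[>] 0) (𝓝 y) := by
    have : Continuous (fun s : ℝ => y - s • w) := by fun_prop
    simpa using (this.tendsto 0).mono_left nhdsWithin_le_nhds
  filter_upwards [key w hw, key2, c1.eventually hev, c2.eventually hev] with s h1 h2 h3 h4
  refine ⟨fun hcl => ?_, h4.1.2 h2⟩
  rw [closure_eq_self_union_frontier] at hcl
  rcases hcl with h | h
  · exact absurd (h3.1.1 h) h1.not_gt
  · exact h1.ne' (h3.2.1 h)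

/-- A set that contains a short segment in every direction of an open half space has unique
derivatives at the base point. -/
theorem uniqueDiffWithinAt_of_eventually_add_smul_mem {S : Set E3} {y : E3} (ℓ : E3 →L[ℝ] ℝ)
    (hℓ : ℓ ≠ 0) (h : ∀ w, 0 < ℓ w → ∀ᶠ s in 𝓝[>] (0 : ℝ), y + s • w ∈ S) :
    UniqueDiffWithinAt ℝ S y := by
  obtain ⟨v, hv⟩ : ∃ v, 0 < ℓ v := by
    obtain ⟨v, hv⟩ : ∃ v, ℓ v ≠ 0 := by
      by_contra! h0
      exact hℓ (ContinuousLinearMap.ext h0)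
    rcases hv.lt_or_gt with h1 | h1
    · exact ⟨-v, by simpa using h1⟩
    · exact ⟨v, h1⟩
  refine ⟨?_, ?_⟩
  -- The tangent cone contains a nonempty open half space, which spans everything.
  · have hsub : {w | 0 < ℓ w} ⊆ (Submodule.span ℝ (tangentConeAt ℝ S y) : Set E3) := by
      intro w hw
      refine Submodule.subset_span (mem_tangentConeAt_of_add_smul_mem (l := 𝓝[>] (0 : ℝ))
        (c := id) ?_ (h w hw))
      exact tendsto_id.mono_left (nhdsWithin_mono (0 : ℝ) (fun s (hs : (0 : ℝ) < s) => hs.ne'))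
    have hopen : IsOpen {w | 0 < ℓ w} := isOpen_lt continuous_const ℓ.continuous
    have htop := Submodule.eq_top_of_nonempty_interior' (Submodule.span ℝ (tangentConeAt ℝ S y))
      ⟨v, interior_mono hsub (by rw [hopen.interior_eq]; exact hv)⟩
    rw [htop]
    simp
  · refine mem_closure_of_tendsto ?_ (h v hv)
    have : Continuous (fun s : ℝ => y + s • v) := by fun_prop
    simpa using (this.tendsto 0).mono_left nhdsWithin_le_nhds

theorem IsLocalDefiningFunction.fderiv_ne_zero {D : Set E3} {y : E3} {ψ : E3 → ℝ}
    (hψ : IsLocalDefiningFunction D y ψ) : fderiv ℝ ψ y ≠ 0 := by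
  intro h
  exact hψ.2.1 (by simp [gradient, h])

/-! ### Tangential projection and surface derivatives -/

theorem tangProj_apply (n w : E3) : tangProj n w = w - inner ℝ n w • n := by
  simp [tangProj]

theorem contDiff_tangProj : ContDiff ℝ 1 (tangProj : E3 → E3 →L[ℝ] E3) := by
  unfold tangProj
  have h1 : ContDiff ℝ 1 (fun n : E3 => innerSL ℝ n) := (innerSL ℝ : E3 →L⋆[ℝ] _).contDiff
  exact contDiff_const.sub (h1.smulRight contDiff_id)

theorem norm_eq_one_of_isOutwardUnitNormal {D : Set E3} {y n : E3}
    (h : IsOutwardUnitNormal D y n) : ‖n‖ = 1 := by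
  obtain ⟨ψ, hψ, rfl⟩ := h
  rw [norm_smul, norm_inv, norm_norm, inv_mul_cancel₀ hψ.norm_gradient_pos.ne']

theorem inner_tangProj_self {n : E3} (hn : ‖n‖ = 1) (w : E3) : inner ℝ n (tangProj n w) = 0 := by
  rw [tangProj_apply, inner_sub_right, inner_smul_right, real_inner_self_eq_norm_sq, hn]
  ring

theorem tangProj_self {n : E3} (hn : ‖n‖ = 1) : tangProj n n = 0 := by
  rw [tangProj_apply, real_inner_self_eq_norm_sq, hn]
  simp

/-- The surface derivative of `f` on the boundary is any derivative of `f` within the boundary,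
composed with the projection. -/
theorem surfDeriv_frontier_apply {F : Type*} [NormedAddCommGroup F]
    [NormedSpace ℝ F] {D : Set E3} {y : E3} {N : E3 → E3} (hN : IsOutwardUnitNormal D y (N y))
    (hy : y ∈ frontier D) {f : E3 → F} {f' : E3 →L[ℝ] F}
    (hf : HasFDerivWithinAt f f' (frontier D) y) (w : E3) :
    surfDeriv (frontier D) N f y w = f' (tangProj (N y) w) := by
  have hn := norm_eq_one_of_isOutwardUnitNormal hN
  obtain ⟨ψ, hψ, hNψ⟩ := hN
  refine hψ.fderivWithin_frontier_apply hy hf ?_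
  have h := inner_tangProj_self hn w
  nth_rewrite 1 [hNψ] at h
  rw [real_inner_smul_left, inner_gradient_left] at h
  exact (mul_eq_zero.1 h).resolve_left (inv_ne_zero hψ.norm_gradient_pos.ne')

/-- The derivative within `A` is continuous up to the boundary and is the ordinary one on the open
part `W`; this yields every one-sided limit. -/
theorem tendsto_fderiv_apply {F : Type*} [NormedAddCommGroup F] [NormedSpace ℝ F] {A W : Set E3}
    (hA : UniqueDiffOn ℝ A) (hW : IsOpen W) (hWA : W ⊆ A) {f : E3 → F} (hf : ContDiffOn ℝ 1 f A)
    {w : E3 → E3} (hw : ContinuousOn w A) {x : E3} (hx : x ∈ A) :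
    Tendsto (fun y => fderiv ℝ f y (w y)) (𝓝[W] x) (𝓝 (fderivWithin ℝ f A x (w x))) := by
  have h1 : ContinuousOn (fun y => fderivWithin ℝ f A y (w y)) A :=
    (hf.continuousOn_fderivWithin hA le_rfl).clm_apply hw
  refine ((h1 x hx).tendsto.mono_left (nhdsWithin_mono x hWA)).congr' ?_
  filter_upwards [self_mem_nhdsWithin] with y hy
  rw [fderivWithin_of_mem_nhds (mem_of_superset (hW.mem_nhds hy) hWA)]

/-- In an orthonormal frame `(n, t, b)`, the tangential projection is the projection onto the
span of `t` and `b`. -/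
theorem tangProj_eq_of_orthonormal {n t b : E3} (h : Orthonormal ℝ ![n, t, b]) (w : E3) :
    tangProj n w = inner ℝ t w • t + inner ℝ b w • b := by
  have hspan : ⊤ ≤ Submodule.span ℝ (range ![n, t, b]) :=
    (h.linearIndependent.span_eq_top_of_card_eq_finrank (by simp)).ge
  have hs := (OrthonormalBasis.mk h hspan).sum_repr' w
  simp only [OrthonormalBasis.coe_mk, Fin.sum_univ_three] at hs
  simp only [Matrix.cons_val_zero, Matrix.cons_val_one, Matrix.cons_val] at hs
  rw [tangProj_apply]
  nth_rewrite 1 [← hs]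
  abel

theorem inner_stdVec (v : E3) (i : Fin 3) : inner ℝ v (stdVec i) = v i := by
  simp [stdVec, EuclideanSpace.inner_single_right]

theorem sum_smul_stdVec (v : E3) : ∑ i, v i • stdVec i = v := by
  ext j
  simp [stdVec, Fin.sum_univ_three]
  fin_cases j <;> simp

theorem sum_apply_mul_apply (v w : E3) : ∑ i, v i * w i = inner ℝ v w := by
  simp [PiLp.inner_apply, mul_comm]

/-- The trace of a bilinear map over the tangent plane, in the standard basis and in a frame. -/
theorem sum_apply_tangProj_stdVec {F : Type*} [NormedAddCommGroup F] [NormedSpace ℝ F]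
    {n t b : E3} (h : Orthonormal ℝ ![n, t, b]) (B : E3 →L[ℝ] E3 →L[ℝ] F) :
    ∑ i, B (tangProj n (stdVec i)) (tangProj n (stdVec i)) = B t t + B b b := by
  have htt : inner ℝ t t = 1 := by
    simpa using (orthonormal_iff_ite.1 h) 1 1
  have hbb : inner ℝ b b = 1 := by
    simpa using (orthonormal_iff_ite.1 h) 2 2
  have htb : inner ℝ t b = 0 := by
    simpa using (orthonormal_iff_ite.1 h) 1 2
  have key : ∀ i, B (tangProj n (stdVec i)) (tangProj n (stdVec i)) =
      (t i * t i) • B t t + (t i * b i) • B t b + (t i * b i) • B b t + (b i * b i) • B b b := by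
    intro i
    rw [tangProj_eq_of_orthonormal h, inner_stdVec, inner_stdVec]
    simp only [map_add, map_smul, add_apply, smul_apply, smul_add, smul_smul]
    rw [mul_comm (b i) (t i)]
    abel
  simp only [key, Finset.sum_add_distrib, ← Finset.sum_smul, sum_apply_mul_apply, htt, hbb, htb]
  simp

/-- Product rule for e − ⟨N, e⟩N; these are the curvature terms of the surface Laplacian. -/
theorem hasFDerivWithinAt_tangProj_apply {A : Set E3} {x : E3} {N : E3 → E3}
    {N' : E3 →L[ℝ] E3} (hN : HasFDerivWithinAt N N' A x) (e : E3) :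
    ∃ P' : E3 →L[ℝ] E3, HasFDerivWithinAt (fun z => tangProj (N z) e) P' A x ∧
      ∀ w, P' w = -(inner ℝ (N x) e • N' w + inner ℝ (N' w) e • N x) := by
  have h1 := ((hN.inner ℝ (hasFDerivWithinAt_const e x A)).smul hN).const_sub e
  simp only [tangProj_apply]
  refine ⟨_, h1, fun w => ?_⟩
  simp

/-! ### Limits from one side -/

/-- One side of the interface. The one-sided limits of the extended surface Laplacian and of the
tangential second derivatives exist, the former is the intrinsic surface Laplacian, and the two
have the same normal component. -/
theorem tendsto_surfLaplacian_and_secondDirDeriv {D U V : Set E3} {u N : E3 → E3} {x t b : E3}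
    (hU : IsOpen U) (hUD : UniqueDiffOn ℝ (U ∪ frontier D))
    (hu : ContDiffOn ℝ 2 u (U ∪ frontier D))
    (hV : IsOpen V) (hDV : frontier D ⊆ V) (hN : ContDiffOn ℝ 1 N V)
    (hnormal : ∀ y ∈ frontier D, IsOutwardUnitNormal D y (N y))
    (hdiv : ∀ y ∈ U, divergence u y = 0) (hx : x ∈ frontier D)
    (hsurf : surfDiv (frontier D) N u x = 0) (hxU : (𝓝[U] x).NeBot)
    (hframe : Orthonormal ℝ ![N x, t, b]) :
    Tendsto (surfLaplacian univ N u) (𝓝[U] x) (𝓝 (surfLaplacian (frontier D) N u x)) ∧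
    ∃ K, Tendsto (fun y => secondDirDeriv t u y + secondDirDeriv b u y) (𝓝[U] x) (𝓝 K) ∧
      inner ℝ (surfLaplacian (frontier D) N u x) (N x) = inner ℝ K (N x) := by
  set A := (U ∪ frontier D) ∩ V with hAdef
  set W := U ∩ V with hWdef
  have hA : UniqueDiffOn ℝ A := hUD.inter hV
  have hW : IsOpen W := hU.inter hV
  have hWA : W ⊆ A := inter_subset_inter_left _ subset_union_left
  have hDA : frontier D ⊆ A := subset_inter subset_union_right hDV
  have hxA : x ∈ A := hDA hx
  have hWx : 𝓝[W] x = 𝓝[U] x := nhdsWithin_inter_of_mem' (mem_nhdsWithin_of_mem_nhds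
    (hV.mem_nhds (hDV hx)))
  rw [← hWx] at hxU ⊢
  have huA : ContDiffOn ℝ 2 u A := hu.mono inter_subset_left
  have hNA : ContDiffOn ℝ 1 N A := hN.mono inter_subset_right
  have hDu : ContDiffOn ℝ 1 (fderivWithin ℝ u A) A := huA.fderivWithin hA (by norm_num)
  have hP : ContDiffOn ℝ 1 (fun z => tangProj (N z)) A := contDiff_tangProj.comp_contDiffOn hNA
  have hPe : ∀ e, ContDiffOn ℝ 1 (fun z => tangProj (N z) e) A :=
    fun e => hP.clm_apply contDiffOn_const
  have hg : ∀ e, ContDiffOn ℝ 1 (fun z => fderivWithin ℝ u A z (tangProj (N z) e)) A :=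
    fun e => hDu.clm_apply (hPe e)
  have hn : ‖N x‖ = 1 := norm_eq_one_of_isOutwardUnitNormal (hnormal x hx)
  have hudiff : ∀ y ∈ A, HasFDerivWithinAt u (fderivWithin ℝ u A y) A y := fun y hy =>
    (huA.differentiableOn two_ne_zero y hy).hasFDerivWithinAt
  have hDuW : ∀ y ∈ W, fderiv ℝ u y = fderivWithin ℝ u A y := fun y hy =>
    (fderivWithin_of_mem_nhds (mem_of_superset (hW.mem_nhds hy) hWA)).symm
  -- the intrinsic surface derivatives are the one-sided ones
  have hsd : ∀ y ∈ frontier D, ∀ e, surfDeriv (frontier D) N u y e =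
      fderivWithin ℝ u A y (tangProj (N y) e) := fun y hy e =>
    surfDeriv_frontier_apply (hnormal y hy) hy ((hudiff y (hDA hy)).mono hDA) e
  have hlap : surfLaplacian (frontier D) N u x = ∑ i, fderivWithin ℝ
      (fun z => fderivWithin ℝ u A z (tangProj (N z) (stdVec i))) A x
      (tangProj (N x) (stdVec i)) := by
    refine Finset.sum_congr rfl fun i _ => ?_
    -- On Γ the inner surface derivative agrees with a field that is C¹ up to Γ, so the outer one
    -- can be computed from that field.
    refine surfDeriv_frontier_apply (hnormal x hx) hx ?_ _
    exact ((((hg (stdVec i)).differentiableOn one_ne_zero x hxA).hasFDerivWithinAt).mono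
      hDA).congr (fun z hz => hsd z hz _) (hsd x hx _)
  -- the divergence conditions annihilate the normal component of the normal derivative
  have hdivx : ∑ i, (fderivWithin ℝ u A x (stdVec i)) i = 0 := by
    have h1 : Tendsto (divergence u) (𝓝[W] x)
        (𝓝 (∑ i, (fderivWithin ℝ u A x (stdVec i)) i)) := by
      refine tendsto_finsetSum _ fun i _ => ?_
      exact ((EuclideanSpace.proj (𝕜 := ℝ) i).continuous.tendsto _).comp
        (tendsto_fderiv_apply hA hW hWA (huA.of_le (by norm_num))
          (w := fun _ => stdVec i) continuousOn_const hxA)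
    refine tendsto_nhds_unique h1 (tendsto_const_nhds.congr' ?_)
    filter_upwards [self_mem_nhdsWithin] with y hy
    exact (hdiv y hy.1).symm
  have hnn : inner ℝ (fderivWithin ℝ u A x (N x)) (N x) = 0 := by
    have h2 : ∑ i, (fderivWithin ℝ u A x (tangProj (N x) (stdVec i))) i = 0 := by
      rw [← hsurf]
      exact Finset.sum_congr rfl fun i _ => by rw [hsd x hx]
    have h3 : ∀ i, (fderivWithin ℝ u A x (tangProj (N x) (stdVec i))) i =
        (fderivWithin ℝ u A x (stdVec i)) i - (fderivWithin ℝ u A x (N x)) i * N x i := by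
      intro i
      rw [tangProj_apply, inner_stdVec, map_sub, map_smul, PiLp.sub_apply, PiLp.smul_apply,
        smul_eq_mul, mul_comm]
    simp only [h3, Finset.sum_sub_distrib, hdivx, sum_apply_mul_apply] at h2
    linarith
  set B := fderivWithin ℝ (fderivWithin ℝ u A) A x with hB
  have hBx : HasFDerivWithinAt (fderivWithin ℝ u A) B A x :=
    (hDu.differentiableOn one_ne_zero x hxA).hasFDerivWithinAt
  refine ⟨?_, B t t + B b b, ?_, ?_⟩
  · rw [hlap]
    refine tendsto_finsetSum _ fun i _ => ?_
    refine (tendsto_fderiv_apply hA hW hWA (hg (stdVec i)) (hPe (stdVec i)).continuousOn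
      hxA).congr' ?_
    filter_upwards [self_mem_nhdsWithin] with y hy
    simp only [surfDeriv, fderivWithin_univ, ContinuousLinearMap.comp_apply]
    refine congrArg (fun L : E3 →L[ℝ] E3 => L (tangProj (N y) (stdVec i)))
      (Filter.EventuallyEq.fderiv_eq ?_)
    filter_upwards [hW.mem_nhds hy] with z hz
    rw [hDuW z hz]
  · have key : ∀ τ, Tendsto (secondDirDeriv τ u) (𝓝[W] x) (𝓝 (B τ τ)) := by
      intro τ
      have h1 := tendsto_fderiv_apply hA hW hWA (hDu.clm_apply (contDiffOn_const (c := τ)))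
        (w := fun _ => τ) continuousOn_const hxA
      have h2 := (hBx.clm_apply (hasFDerivWithinAt_const τ x A)).fderivWithin (hA x hxA)
      rw [h2] at h1
      simp only [ContinuousLinearMap.comp_zero, zero_add, ContinuousLinearMap.flip_apply] at h1
      refine h1.congr' ?_
      filter_upwards [self_mem_nhdsWithin] with y hy
      refine congrArg (fun L : E3 →L[ℝ] E3 => L τ) (Filter.EventuallyEq.fderiv_eq ?_)
      filter_upwards [hW.mem_nhds hy] with z hz
      rw [hDuW z hz]
    exact (key t).add (key b)
  · have hNx : HasFDerivWithinAt N (fderivWithin ℝ N A x) A x :=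
      (hNA.differentiableOn one_ne_zero x hxA).hasFDerivWithinAt
    have hterm : ∀ i, fderivWithin ℝ
        (fun z => fderivWithin ℝ u A z (tangProj (N z) (stdVec i))) A x
          (tangProj (N x) (stdVec i)) =
        B (tangProj (N x) (stdVec i)) (tangProj (N x) (stdVec i)) -
        (fderivWithin ℝ u A x (fderivWithin ℝ N A x (tangProj (N x) (N x i • stdVec i))) +
          (fderivWithin ℝ N A x (tangProj (N x) (stdVec i))) i •
            fderivWithin ℝ u A x (N x)) := by
      intro i
      obtain ⟨P', hP', hPw⟩ := hasFDerivWithinAt_tangProj_apply hNx (stdVec i)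
      rw [(hBx.clm_apply hP').fderivWithin (hA x hxA), add_apply,
        ContinuousLinearMap.comp_apply, ContinuousLinearMap.flip_apply, hPw, inner_stdVec,
        inner_stdVec]
      simp only [map_neg, map_add, map_smul]
      abel
    rw [hlap]
    -- Summing `N x i • stdVec i` restores `N x`, which the projection kills; what remains is a
    -- multiple of Du(n), removed by `hnn`.
    simp only [hterm, Finset.sum_sub_distrib, Finset.sum_add_distrib, ← map_sum,
      sum_smul_stdVec, tangProj_self hn, map_zero, zero_add, ← Finset.sum_smul]
    rw [sum_apply_tangProj_stdVec hframe, inner_sub_left, real_inner_smul_left, hnn]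
    simp

/-! ### Both sides and the jumps -/

/-- The sign of `σ` selects the side, so one argument serves the exterior (`1`) and the interior
(`-1`). -/
theorem HasC2Boundary.uniqueDiffOn_union_frontier {D U : Set E3} (hD : HasC2Boundary D)
    (hU : IsOpen U) (σ : ℝ) (hσ : σ ≠ 0)
    (h : ∀ y ∈ frontier D, ∀ ψ, IsLocalDefiningFunction D y ψ → ∀ w, 0 < fderiv ℝ ψ y w →
      ∀ᶠ s in 𝓝[>] (0 : ℝ), y + s • σ • w ∈ U) :
    UniqueDiffOn ℝ (U ∪ frontier D) := by
  rintro y (hy | hy)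
  · exact (hU.uniqueDiffWithinAt hy).mono subset_union_left
  · obtain ⟨ψ, hψ⟩ := hD y hy
    refine (uniqueDiffWithinAt_of_eventually_add_smul_mem (σ⁻¹ • fderiv ℝ ψ y)
      (smul_ne_zero (inv_ne_zero hσ) hψ.fderiv_ne_zero) fun w hw => ?_).mono subset_union_left
    have h1 := h y hy ψ hψ (σ⁻¹ • w) (by simpa using hw)
    simpa only [smul_inv_smul₀ hσ] using h1

theorem mainTheorem9
    -- the domain, the enclosed region, and the closed interface `frontier Ωm`
    (Ω Ωm : Set E3) (hΩ_open : IsOpen Ω) (hΩ_conn : IsConnected Ω)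
    (hΩ_bdd : Bornology.IsBounded Ω) (hΩm_open : IsOpen Ωm) (hΩm_sub : closure Ωm ⊆ Ω)
    (hΓ : HasC2Boundary Ωm)
    -- the piecewise constant viscosity
    (μ : E3 → ℝ) (μp μm : ℝ)
    (hμp : ∀ y ∈ Ω \ closure Ωm, μ y = μp) (hμm : ∀ y ∈ Ωm, μ y = μm)
    -- the velocity: `C²` up to the interface from each side, with a common value there
    (u : E3 → E3)
    (hup : ContDiffOn ℝ 2 u ((Ω \ closure Ωm) ∪ frontier Ωm))
    (hum : ContDiffOn ℝ 2 u (Ωm ∪ frontier Ωm))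
    -- a `C¹` extension of the outward unit normal field to a neighbourhood of the interface
    (V : Set E3) (hV_open : IsOpen V) (hΓV : frontier Ωm ⊆ V)
    (N : E3 → E3) (hN : ContDiffOn ℝ 1 N V)
    (hN_normal : ∀ y ∈ frontier Ωm, IsOutwardUnitNormal Ωm y (N y))
    -- incompressibility of both fluids and of the interface
    (hdivp : ∀ y ∈ Ω \ closure Ωm, divergence u y = 0)
    (hdivm : ∀ y ∈ Ωm, divergence u y = 0)
    (hsurf : ∀ y ∈ frontier Ωm, surfDiv (frontier Ωm) N u y = 0)
    -- a point of the interface and an orthonormal frame there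
    (x : E3) (hx : x ∈ frontier Ωm)
    (t b : E3) (hframe : Orthonormal ℝ ![N x, t, b]) :
    ∃ J K : E3,
      HasJump (fun y => μ y • surfLaplacian univ N u y) x (N x) J ∧
      J = μp • surfLaplacian (frontier Ωm) N u x - μm • surfLaplacian (frontier Ωm) N u x ∧
      HasJump (fun y => μ y • (secondDirDeriv t u y + secondDirDeriv b u y)) x (N x) K ∧
      inner ℝ J (N x) = inner ℝ K (N x) := by
  have hUp : IsOpen (Ω \ closure Ωm) := hΩ_open.sdiff isClosed_closure
  have hline : ∀ y v : E3, Tendsto (fun s : ℝ => y + s • v) (𝓝[>] 0) (𝓝 y) := by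
    intro y v
    have : Continuous (fun s : ℝ => y + s • v) := by fun_prop
    simpa using (this.tendsto 0).mono_left nhdsWithin_le_nhds
  have hmemp : ∀ y ∈ frontier Ωm, ∀ ψ, IsLocalDefiningFunction Ωm y ψ →
      ∀ w, 0 < fderiv ℝ ψ y w → ∀ᶠ s in 𝓝[>] (0 : ℝ), y + s • w ∈ Ω \ closure Ωm := by
    intro y hy ψ hψ w hw
    filter_upwards [hψ.eventually_pos hy hw, (hline y w).eventually
      (hΩ_open.mem_nhds (hΩm_sub (frontier_subset_closure hy)))] with s h1 h2
    exact ⟨h2, h1.1⟩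
  have hmemm : ∀ y ∈ frontier Ωm, ∀ ψ, IsLocalDefiningFunction Ωm y ψ →
      ∀ w, 0 < fderiv ℝ ψ y w → ∀ᶠ s in 𝓝[>] (0 : ℝ), y - s • w ∈ Ωm := fun y hy ψ hψ w hw =>
    (hψ.eventually_pos hy hw).mono fun s hs => hs.2
  have hUDp : UniqueDiffOn ℝ ((Ω \ closure Ωm) ∪ frontier Ωm) :=
    hΓ.uniqueDiffOn_union_frontier hUp 1 one_ne_zero (by simpa only [one_smul] using hmemp)
  have hUDm : UniqueDiffOn ℝ (Ωm ∪ frontier Ωm) :=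
    hΓ.uniqueDiffOn_union_frontier hΩm_open (-1) (by norm_num)
      (by simpa only [neg_smul, one_smul, smul_neg, ← sub_eq_add_neg] using hmemm)
  obtain ⟨ψ, hψ, hNψ⟩ := hN_normal x hx
  -- This derivative is the norm of the gradient, so the normal line crosses Γ transversally.
  have hpos : 0 < fderiv ℝ ψ x (N x) := by
    rw [hNψ, ← inner_gradient_left, real_inner_smul_right, real_inner_self_eq_norm_sq]
    have := hψ.norm_gradient_pos
    positivity
  have hp := hmemp x hx ψ hψ _ hpos
  have hm := hmemm x hx ψ hψ _ hpos
  have htp : Tendsto (fun s : ℝ => x + s • N x) (𝓝[>] 0) (𝓝[Ω \ closure Ωm] x) :=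
    tendsto_nhdsWithin_iff.2 ⟨hline x (N x), hp⟩
  have htm : Tendsto (fun s : ℝ => x - s • N x) (𝓝[>] 0) (𝓝[Ωm] x) :=
    tendsto_nhdsWithin_iff.2
      ⟨by simpa only [smul_neg, ← sub_eq_add_neg] using hline x (-N x), hm⟩
  obtain ⟨hLp, Kp, hKp, hip⟩ := tendsto_surfLaplacian_and_secondDirDeriv hUp hUDp hup hV_open
    hΓV hN hN_normal hdivp hx (hsurf x hx) htp.neBot hframe
  obtain ⟨hLm, Km, hKm, him⟩ := tendsto_surfLaplacian_and_secondDirDeriv hΩm_open hUDm hum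
    hV_open hΓV hN hN_normal hdivm hx (hsurf x hx) htm.neBot hframe
  have hjump : ∀ (f : E3 → E3) (a c : E3), Tendsto f (𝓝[Ω \ closure Ωm] x) (𝓝 a) →
      Tendsto f (𝓝[Ωm] x) (𝓝 c) →
      HasJump (fun y => μ y • f y) x (N x) (μp • a - μm • c) := by
    intro f a c ha hc
    refine ⟨μp • a, μm • c, ?_, ?_, rfl⟩
    · refine ((ha.comp htp).const_smul μp).congr' ?_
      filter_upwards [hp] with s hs
      simp only [Function.comp_apply, hμp _ hs]
    · refine ((hc.comp htm).const_smul μm).congr' ?_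
      filter_upwards [hm] with s hs
      simp only [Function.comp_apply, hμm _ hs]
  refine ⟨_, _, hjump _ _ _ hLp hLm, rfl, hjump _ _ _ hKp hKm, ?_⟩
  simp only [inner_sub_left, real_inner_smul_left, ← hip, ← him]
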